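/- For every $m\in\mathbb N$ let $p_{1,m},\dots,p_{m,m}\in[0,1]$ be $p$-values on a probability space $(\Omega_m,\mathcal A_m,P_m)$ and let $\{1,\dots,m\}=I_{0,m}\cup I_{1,m}$ be a nonrandom disjoint decomposition into true nulls $I_{0,m}$ and false nulls $I_{1,m}$, with $m_0=\#I_{0,m}\ge 1$ and $m_1=\#I_{1,m}$. Assume that the vectors $(p_{i,m})_{i\in I_{0,m}}$ and $(p_{i,m})_{i\in I_{1,m}}$ are independent and that the $p_{i,m}$, $i\in I_{0,m}$, are i.i.d. uniformly distributed on $[0,1]$ (the joint distribution of the $p_{i,m}$, $i\in I_{1,m}$, is arbitrary). Let $0<\alpha<1$ and $\alpha\le\lambda<1$ be fixed, let $\widehat F_m$ be the empirical distribution function of $p_{1,m},\dots,p_{m,m}$ and $R_m(\lambda)=m\widehat F_m(\lambda)$, and let $\widehat m_0=\widehat m_0((\widehat F_m(t))_{t\ge\lambda})>0$ be an estimator that is a measurable function (which may depend on $m$) of $(\widehat F_m(t))_{t\ge\lambda}$. Consider the adaptive step-up test with critical values $\widehat\alpha_{i:m}=\min\{\tfrac{i}{\widehat m_0}\alpha,\lambda\}$,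 $0\le i\le m$: with the ordered $p$-values $p_{1:m}\le\dots\le p_{m:m}$ and $p_{0:m}:=0$, put $R_m=\max\{i\in\{0,\dots,m\}:p_{i:m}\le\widehat\alpha_{i:m}\}$, reject the $i$-th null hypothesis iff $p_{i,m}\le\widehat\alpha_{R_m:m}$, and let $V_m=\#\{i\in I_{0,m}:p_{i,m}\le\widehat\alpha_{R_m:m}\}$ be the number of false rejections. Let $\mathrm{FDR}_m=E(V_m/R_m)$, with $0/0=0$. The sequence of tests is called consistent if $V_m/R_m-E(V_m/R_m)\to0$ in $P_m$-probability as $m\to\infty$. Suppose that $\liminf_{m\to\infty}\mathrm{FDR}_m>0$ and that there is a constant $C>1$ with $$\lim_{m\to\infty}P_m\Bigl(\widehat m_0\ge\frac{C\alpha}{\lambda}\,(R_m(\lambda)\vee1)\Bigr)=1 .$$ Then the following hold. (a) If the sequence of tests is consistent, then $m_1\to\infty$. (b) If $m_0/m\to\kappa_0$ for some $\kappa_0\in(0,1]$, and if for every $m$ the false-null $p$-values $(p_{i,m})_{i\in I_{1,m}}$ are i.i.d. uniformly distributed on $[0,\lambda]$, then the sequence of tests is not consistent. -/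

import Mathlib

open MeasureTheory ProbabilityTheory Filter Topology

namespace AdaptiveStepUp

noncomputable section

/-- The empirical distribution function `t ↦ F̂ₘ(t)` of the p-values `x 0, …, x (m - 1)`. -/
def empCDF {m : ℕ} (x : Fin m → ℝ) (t : ℝ) : ℝ :=
  ((Finset.univ.filter fun i => x i ≤ t).card : ℝ) / m

/-- `Rₘ(t) = m F̂ₘ(t)`, the number of p-values that are at most `t`. -/
def countLE {m : ℕ} (x : Fin m → ℝ) (t : ℝ) : ℝ := m * empCDF x t

/-- The order statistic `p_{i:m}` for `1 ≤ i ≤ m` (the `i`-th smallest p-value), with `p_{0:m} = 0`.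
Indices above `m` are never used. -/
def orderStat {m : ℕ} (x : Fin m → ℝ) (i : ℕ) : ℝ :=
  if h : 1 ≤ i ∧ i ≤ m then x (Tuple.sort x ⟨i - 1, by omega⟩) else 0

/-- The value of an estimator of `m₀` that is a function `g` of `(F̂ₘ(t))_{t ≥ lam}`. -/
def estimate {m : ℕ} (lam : ℝ) (g : (Set.Ici lam → ℝ) → ℝ) (x : Fin m → ℝ) : ℝ :=
  g fun t => empCDF x t

/-- The data dependent critical values `α̂_{i:m} = min {(i / m̂₀) α, lam}`. -/
def critVal {m : ℕ} (α lam : ℝ) (g : (Set.Ici lam → ℝ) → ℝ) (x : Fin m → ℝ) (i : ℕ) : ℝ :=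
  min ((i : ℝ) / estimate lam g x * α) lam

/-- The number of rejections `Rₘ = max {i = 0, …, m : p_{i:m} ≤ α̂_{i:m}}`. -/
def numRej {m : ℕ} (α lam : ℝ) (g : (Set.Ici lam → ℝ) → ℝ) (x : Fin m → ℝ) : ℕ :=
  Nat.findGreatest (fun i => orderStat x i ≤ critVal α lam g x i) m

/-- The number `Vₘ` of falsely rejected nulls; the `i`-th null hypothesis is rejected iff
`p_i ≤ α̂_{Rₘ:m}`, and `I₀` is the set of true nulls. -/
def numFalseRej {m : ℕ} (α lam : ℝ) (g : (Set.Ici lam → ℝ) → ℝ) (I₀ : Finset (Fin m))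
    (x : Fin m → ℝ) : ℕ :=
  (I₀.filter fun i => x i ≤ critVal α lam g x (numRej α lam g x)).card

/-- The false discovery proportion `Vₘ / Rₘ`, with `0 / 0 = 0`. -/
def fdp {m : ℕ} (α lam : ℝ) (g : (Set.Ici lam → ℝ) → ℝ) (I₀ : Finset (Fin m))
    (x : Fin m → ℝ) : ℝ :=
  (numFalseRej α lam g I₀ x : ℝ) / (numRej α lam g x : ℝ)

/-- The false discovery rate, the expectation of the false discovery proportion. -/
def fdr {m : ℕ} {Ω : Type*} [MeasurableSpace Ω] (P : Measure Ω) (p : Fin m → Ω → ℝ)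
    (α lam : ℝ) (g : (Set.Ici lam → ℝ) → ℝ) (I₀ : Finset (Fin m)) : ℝ :=
  ∫ ω, fdp α lam g I₀ (fun i => p i ω) ∂P

/-- The basic independence model with true nulls `I₀` and false nulls `I₀ᶜ`. -/
structure BasicIndependence {m : ℕ} {Ω : Type*} [MeasurableSpace Ω] (P : Measure Ω)
    (p : Fin m → Ω → ℝ) (I₀ : Finset (Fin m)) : Prop where
  measurable : ∀ i, Measurable (p i)
  mem_Icc : ∀ i ω, p i ω ∈ Set.Icc (0 : ℝ) 1
  /-- The vector of true null p-values is independent of the vector of false null p-values. -/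
  indep_true_false : IndepFun (fun ω (i : {i // i ∈ I₀}) => p i ω)
    (fun ω (i : {i // i ∈ I₀ᶜ}) => p i ω) P
  /-- The true null p-values are independent. -/
  indep_true : iIndepFun (fun (i : {i // i ∈ I₀}) => p i) P
  /-- The true null p-values are uniformly distributed on `[0, 1]`. -/
  uniform_true : ∀ i ∈ I₀, pdf.IsUniform (p i) (Set.Icc 0 1) P volume

/-- Consistency of a sequence of tests: `FDPₘ - E(FDPₘ) → 0` in `Pₘ`-probability. -/
def Consistent {Ω : ℕ → Type*} [∀ m, MeasurableSpace (Ω m)] (P : ∀ m, Measure (Ω m))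
    (p : ∀ m, Fin m → Ω m → ℝ) (α lam : ℝ) (g : ℕ → (Set.Ici lam → ℝ) → ℝ)
    (I₀ : ∀ m, Finset (Fin m)) : Prop :=
  ∀ ε : ℝ, 0 < ε → Tendsto (fun m => P m {ω | ε ≤
    |fdp α lam (g m) (I₀ m) (fun i => p m i ω) - fdr (P m) (p m) α lam (g m) (I₀ m)|})
    atTop (𝓝 0)

end

end AdaptiveStepUp

open AdaptiveStepUp

/-! The FDP vanishes on `V = 0`, so consistency together with a positive `liminf` of the FDR forces
`P(V = 0) → 0`. Both parts therefore follow once `P(V = 0)` is bounded away from zero: along a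
subsequence in (a), eventually in (b).

The lower bound is a leave-one-out argument. Put `b = α / m̂₀`, let `I` contain the true nulls, let
`s` be the number of p-values outside `I` that are at most `lam`, and work on the event that all
p-values in `I` exceed some `a ≥ s * b`. A rejection in `I` at level `r * b` needs at least `max 1
(r - s)` p-values of `I` in `(a, r * b]`. Give each of them the reciprocal weight, with `r` replaced
by a version `r_i` that ignores the position of `p_i`. The total weight is at least one
(`one_le_sum_of_crossesAt`). Since `m̂₀` sees p-values below `lam` only through their number, `p_i`
can be integrated out with `r_i` and `b` fixed. This costs at most `b / (lam - a)` for each `p_i` in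
`(a, lam]`, and the bound on `m̂₀` gives `R(lam) * b ≤ lam / C`. Hence a rejection has probability
at most `ρ` times that of the event, for any `ρ ≥ (lam / C) / (lam - a)` (`measure_crossing_le`),
and `ρ < 1` can be chosen for small `a`.

For (a), suppose `m₁ ≤ k` infinitely often and take `I = I₀`, `a = 2k / m₀`. All true nulls exceed
`a` with probability `(1 - a) ^ m₀ → exp (-2k)`, and a Markov bound keeps enough of them below `lam`
to ensure `s * b ≤ a`. For (b), all p-values can be integrated out, so `I` is everything, `a = 0`
and `ρ = 1 / C`. -/

namespace AdaptiveStepUp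

open Set Function ENNReal

/-! ### Leave-one-out bound for crossing a random linear boundary -/

section Crossing

variable {ι : Type*}

/-- The number of coordinates of `x` with index in `I` and value in `(a, t]`. -/
noncomputable def countIoc (I : Finset ι) (a : ℝ) (x : ι → ℝ) (t : ℝ) : ℕ :=
  (I.filter fun i => a < x i ∧ x i ≤ t).card

lemma measurable_countIoc (I : Finset ι) (a : ℝ) {t : (ι → ℝ) → ℝ} (ht : Measurable t) :
    Measurable fun x => countIoc I a x (t x) := by
  simp only [countIoc, Finset.card_filter]
  refine Finset.measurable_sum _ fun i _ => Measurable.ite ?_ measurable_const measurable_const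
  exact (measurableSet_lt measurable_const (measurable_pi_apply i)).inter
    (measurableSet_le (measurable_pi_apply i) ht)

lemma measurableSet_forall_lt (I : Finset ι) (a : ℝ) :
    MeasurableSet {x : ι → ℝ | ∀ i ∈ I, a < x i} := by
  have h : {x : ι → ℝ | ∀ i ∈ I, a < x i} = ⋂ i ∈ I, {x | a < x i} := by ext; simp
  rw [h]
  exact Finset.measurableSet_biInter _ fun j _ =>
    measurableSet_lt measurable_const (measurable_pi_apply j)

lemma countIoc_mono (I : Finset ι) (a : ℝ) (x : ι → ℝ) {t u : ℝ} (h : t ≤ u) :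
    countIoc I a x t ≤ countIoc I a x u :=
  Finset.card_le_card (Finset.monotone_filter_right _ fun _ _ hi => ⟨hi.1, hi.2.trans h⟩)

variable [DecidableEq ι]

lemma countIoc_erase {I : Finset ι} {i : ι} (hi : i ∈ I) {a : ℝ} {x : ι → ℝ} {t : ℝ}
    (ha : a < x i) (ht : x i ≤ t) : countIoc (I.erase i) a x t + 1 = countIoc I a x t := by
  unfold countIoc
  rw [Finset.filter_erase, Finset.card_erase_add_one]
  simp [hi, ha, ht]

lemma countIoc_erase_update (I : Finset ι) (i : ι) (a : ℝ) (x : ι → ℝ) (c t : ℝ) :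
    countIoc (I.erase i) a (update x i c) t = countIoc (I.erase i) a x t := by
  unfold countIoc
  congr 1
  refine Finset.filter_congr fun j hj => ?_
  rw [update_of_ne (Finset.ne_of_mem_erase hj)]

/-- The linear boundary `r ↦ r * b` is crossed at `r` by the coordinates in `(a, l]`, where `s`
further coordinates may contribute. -/
def CrossesAt (I : Finset ι) (a l : ℝ) (b : (ι → ℝ) → ℝ) (s : (ι → ℝ) → ℕ) (x : ι → ℝ) (r : ℕ) :
    Prop :=
  r * b x ≤ l ∧ 1 ≤ countIoc I a x (r * b x) ∧ r ≤ s x + countIoc I a x (r * b x)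

/-- The last index up to `M` at which the boundary is crossed if coordinate `i` is counted in any
case. -/
noncomputable def lastCrossing (I : Finset ι) (a l : ℝ) (b : (ι → ℝ) → ℝ) (s : (ι → ℝ) → ℕ) (M : ℕ)
    (i : ι) (x : ι → ℝ) : ℕ :=
  Nat.findGreatest
    (fun r => r * b x ≤ l ∧ r ≤ s x + (countIoc (I.erase i) a x (r * b x) + 1)) M

variable {I : Finset ι} {a l : ℝ} {b : (ι → ℝ) → ℝ} {s : (ι → ℝ) → ℕ} {M : ℕ}

lemma measurable_lastCrossing (hb : Measurable b) (hs : Measurable s) (i : ι) :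
    Measurable (lastCrossing I a l b s M i) := by
  refine measurable_findGreatest fun k _ => ?_
  have hkb : Measurable fun x => (k : ℝ) * b x := hb.const_mul _
  have h : Measurable fun x => s x + (countIoc (I.erase i) a x (k * b x) + 1) :=
    hs.add ((measurable_countIoc _ _ hkb).add measurable_const)
  exact (measurableSet_le hkb measurable_const).inter (measurableSet_le measurable_const h)

lemma lastCrossing_mul_le (hl : 0 ≤ l) (i : ι) (x : ι → ℝ) :
    lastCrossing I a l b s M i x * b x ≤ l := by
  by_cases h : lastCrossing I a l b s M i x = 0
  · simp [h, hl]
  · exact (Nat.findGreatest_of_ne_zero rfl h).1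

/-- The count omits coordinate `i` and adds one unconditionally, so only `b` and `s` could notice a
change of `x i`. This is what allows `x i` to be integrated out. -/
lemma lastCrossing_update {i : ι} {x : ι → ℝ} {c : ℝ} (hb : b (update x i c) = b x)
    (hs : s (update x i c) = s x) :
    lastCrossing I a l b s M i (update x i c) = lastCrossing I a l b s M i x := by
  simp only [lastCrossing, hb, hs, countIoc_erase_update]

/-- If the boundary is crossed, then the coordinates below it carry total weight at least one. -/
lemma one_le_sum_of_crossesAt {x : ι → ℝ} (hb : 0 ≤ b x) {r₀ : ℕ} (hr₀ : r₀ ≤ M)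
    (h : CrossesAt I a l b s x r₀) :
    (1 : ℝ≥0∞) ≤ ∑ i ∈ I, if a < x i ∧ x i ≤ lastCrossing I a l b s M i x * b x then
      (((max 1 (lastCrossing I a l b s M i x - s x) : ℕ) : ℝ≥0∞))⁻¹ else 0 := by
  classical
  set r := Nat.findGreatest (CrossesAt I a l b s x) M with hr
  obtain ⟨h1, h2, h3⟩ : CrossesAt I a l b s x r := Nat.findGreatest_spec hr₀ h
  have hrM : r ≤ M := Nat.findGreatest_le _
  -- A coordinate below the boundary at `r` is below it at every `n ≥ r`, so counting it in any case
  -- changes nothing from `r` on. All these coordinates thus share the true last crossing.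
  have key : ∀ i ∈ I.filter (fun i => a < x i ∧ x i ≤ r * b x),
      lastCrossing I a l b s M i x = r := by
    intro i hi
    obtain ⟨hiI, hai, hir⟩ := Finset.mem_filter.1 hi
    refine Nat.findGreatest_eq_iff.2 ⟨hrM, fun _ => ⟨h1, ?_⟩, fun n hn hnM hcon => ?_⟩
    · rwa [countIoc_erase hiI hai hir]
    · have hle : x i ≤ n * b x := hir.trans (by gcongr)
      rw [countIoc_erase hiI hai hle] at hcon
      refine Nat.findGreatest_is_greatest hn hnM ⟨hcon.1, ?_, hcon.2⟩
      exact h2.trans (countIoc_mono _ _ _ (by gcongr))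
  -- The maximum with one keeps the inverse finite when `s` alone reaches `r`. The crossing still
  -- supplies `w` coordinates, because it includes at least one from `I`.
  set w : ℕ := max 1 (r - s x) with hw
  have hwK : w ≤ countIoc I a x (r * b x) := by omega
  calc (1 : ℝ≥0∞) = w * (w : ℝ≥0∞)⁻¹ :=
        (ENNReal.mul_inv_cancel (by simp; omega) (by simp)).symm
    _ ≤ (countIoc I a x (r * b x) : ℝ≥0∞) * (w : ℝ≥0∞)⁻¹ := by gcongr
    _ = ∑ i ∈ I.filter (fun i => a < x i ∧ x i ≤ r * b x), (w : ℝ≥0∞)⁻¹ := by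
        rw [Finset.sum_const, nsmul_eq_mul]; rfl
    _ = ∑ i ∈ I.filter (fun i => a < x i ∧ x i ≤ r * b x),
          if a < x i ∧ x i ≤ lastCrossing I a l b s M i x * b x then
          (((max 1 (lastCrossing I a l b s M i x - s x) : ℕ) : ℝ≥0∞))⁻¹ else 0 := by
        refine Finset.sum_congr rfl fun i hi => ?_
        rw [key i hi, if_pos (Finset.mem_filter.1 hi).2]
    _ ≤ _ := Finset.sum_le_sum_of_subset (Finset.filter_subset _ _)

/-- Integrating out a variable whose conditional law on `(a, l]` is dominated by the uniform law. -/
lemma lintegral_indicator_le_of_indepFun {Ω E : Type*} [MeasurableSpace Ω] [MeasurableSpace E]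
    {P : Measure Ω} [IsProbabilityMeasure P] {X : Ω → ℝ} {Z : Ω → E} (hX : Measurable X)
    (hZ : Measurable Z) (hind : IndepFun X Z P)
    (hu : ∀ t, a ≤ t → t ≤ l →
      P (X ⁻¹' Ioc a t) ≤ ENNReal.ofReal ((t - a) / (l - a)) * P (X ⁻¹' Ioc a l))
    {τ : E → ℝ} (hτ : Measurable τ) (hτl : ∀ z, τ z ≤ l) {k : E → ℝ≥0∞} (hk : Measurable k) :
    ∫⁻ ω, (Ioc a (τ (Z ω))).indicator (fun _ => k (Z ω)) (X ω) ∂P ≤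
      ∫⁻ ω, (Ioc a l).indicator
        (fun _ => ENNReal.ofReal ((τ (Z ω) - a) / (l - a)) * k (Z ω)) (X ω) ∂P := by
  have hm : P.map (fun ω => (X ω, Z ω)) = (P.map X).prod (P.map Z) :=
    (indepFun_iff_map_prod_eq_prod_map_map hX.aemeasurable hZ.aemeasurable).1 hind
  have : IsProbabilityMeasure (P.map X) := Measure.isProbabilityMeasure_map hX.aemeasurable
  have : IsProbabilityMeasure (P.map Z) := Measure.isProbabilityMeasure_map hZ.aemeasurable
  let F : ℝ × E → ℝ≥0∞ := {q : ℝ × E | a < q.1 ∧ q.1 ≤ τ q.2}.indicator fun q => k q.2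
  let G : ℝ × E → ℝ≥0∞ := {q : ℝ × E | a < q.1 ∧ q.1 ≤ l}.indicator
    fun q => ENNReal.ofReal ((τ q.2 - a) / (l - a)) * k q.2
  have hF : Measurable F := by
    refine Measurable.indicator (hk.comp measurable_snd) ?_
    exact (measurableSet_lt measurable_const measurable_fst).inter
      (measurableSet_le measurable_fst (hτ.comp measurable_snd))
  have hG : Measurable G := by
    refine Measurable.indicator (by fun_prop) ?_
    exact (measurableSet_lt measurable_const measurable_fst).inter
      (measurableSet_le measurable_fst measurable_const)
  have e1 : ∫⁻ ω, (Ioc a (τ (Z ω))).indicator (fun _ => k (Z ω)) (X ω) ∂P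
      = ∫⁻ z, ∫⁻ u, F (u, z) ∂(P.map X) ∂(P.map Z) := by
    rw [← lintegral_prod_symm' _ hF, ← hm, lintegral_map hF (hX.prodMk hZ)]
    rfl
  have e2 : ∫⁻ ω, (Ioc a l).indicator
        (fun _ => ENNReal.ofReal ((τ (Z ω) - a) / (l - a)) * k (Z ω)) (X ω) ∂P
      = ∫⁻ z, ∫⁻ u, G (u, z) ∂(P.map X) ∂(P.map Z) := by
    rw [← lintegral_prod_symm' _ hG, ← hm, lintegral_map hG (hX.prodMk hZ)]
    rfl
  rw [e1, e2]
  refine lintegral_mono fun z => ?_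
  have f1 : ∫⁻ u, F (u, z) ∂(P.map X) = k z * P (X ⁻¹' Ioc a (τ z)) := by
    rw [← Measure.map_apply hX measurableSet_Ioc,
      ← lintegral_indicator_const measurableSet_Ioc (k z)]
    rfl
  have f2 : ∫⁻ u, G (u, z) ∂(P.map X) =
      (ENNReal.ofReal ((τ z - a) / (l - a)) * k z) * P (X ⁻¹' Ioc a l) := by
    rw [← Measure.map_apply hX measurableSet_Ioc,
      ← lintegral_indicator_const measurableSet_Ioc _]
    rfl
  rw [f1, f2]
  rcases le_or_gt a (τ z) with h | h
  · calc k z * P (X ⁻¹' Ioc a (τ z)) ≤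
        k z * (ENNReal.ofReal ((τ z - a) / (l - a)) * P (X ⁻¹' Ioc a l)) := by
          gcongr; exact hu _ h (hτl z)
      _ = _ := by ring
  · simp [Ioc_eq_empty h.not_gt]

set_option maxHeartbeats 1000000 in
/-- Leave-one-out bound for the crossing probability. The boundary `r ↦ r * b` and the
event `H` may depend on the coordinates in `I` only through the set of those exceeding `l`. -/
theorem measure_crossing_le {Ω : Type*} [MeasurableSpace Ω] {P : Measure Ω}
    [IsProbabilityMeasure P] {X : Ω → ι → ℝ} (hX : Measurable X) (hal : a < l) (ha : 0 ≤ a)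
    (hb : Measurable b) (hs : Measurable s) {H : Set (ι → ℝ)} (hH : MeasurableSet H)
    (hbi : ∀ i ∈ I, ∀ x, x i ≤ l → b (update x i l) = b x)
    (hsi : ∀ i ∈ I, ∀ x, x i ≤ l → s (update x i l) = s x)
    (hHi : ∀ i ∈ I, ∀ x, x i ≤ l → (update x i l ∈ H ↔ x ∈ H))
    (hind : ∀ i ∈ I, IndepFun (fun ω => X ω i) (fun ω => update (X ω) i l) P)
    (hu : ∀ i ∈ I, ∀ t, a ≤ t → t ≤ l → P ((fun ω => X ω i) ⁻¹' Ioc a t) ≤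
      ENNReal.ofReal ((t - a) / (l - a)) * P ((fun ω => X ω i) ⁻¹' Ioc a l))
    {ρ : ℝ} (hb0 : ∀ x ∈ H, 0 ≤ b x) (hsb : ∀ x ∈ H, s x * b x ≤ a)
    (hρ : ∀ x ∈ H, countIoc I a x l * b x ≤ ρ * (l - a)) (M : ℕ) :
    P {ω | X ω ∈ H ∧ (∀ i ∈ I, a < X ω i) ∧ ∃ r ≤ M, CrossesAt I a l b s (X ω) r} ≤
      ENNReal.ofReal ρ * P {ω | X ω ∈ H ∧ ∀ i ∈ I, a < X ω i} := by
  have hl : 0 ≤ l := ha.trans hal.le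
  have hla : 0 < l - a := sub_pos.2 hal
  -- The conditioning event with the constraint on coordinate `i` removed, so that it is a function
  -- of the vector with that coordinate overwritten.
  set D : ι → Set (ι → ℝ) := fun i => H ∩ {x | ∀ j ∈ I.erase i, a < x j} with hD
  have hDm : ∀ i, MeasurableSet (D i) := fun i => hH.inter (measurableSet_forall_lt _ _)
  have hDu : ∀ i ∈ I, ∀ x, a < x i → x i ≤ l →
      (update x i l ∈ D i ↔ x ∈ H ∧ ∀ j ∈ I, a < x j) := by
    intro i hi x hax hxl
    simp only [hD, mem_inter_iff, hHi i hi x hxl, mem_ofPred_eq]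
    refine and_congr_right fun _ => ⟨fun h j hj => ?_, fun h j hj => ?_⟩
    · by_cases hji : j = i
      · rwa [hji]
      · simpa [hji] using h j (Finset.mem_erase.2 ⟨hji, hj⟩)
    · rw [update_of_ne (Finset.ne_of_mem_erase hj)]
      exact h j (Finset.mem_of_mem_erase hj)
  set L : ι → (ι → ℝ) → ℕ := lastCrossing I a l b s M with hL
  have hLm : ∀ i, Measurable (L i) := measurable_lastCrossing hb hs
  let k : ι → (ι → ℝ) → ℝ≥0∞ := fun i =>
    (D i).indicator fun z => ((max 1 (L i z - s z) : ℕ) : ℝ≥0∞)⁻¹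
  let τ : ι → (ι → ℝ) → ℝ := fun i z => L i z * b z
  have hτ : ∀ i, Measurable (τ i) := fun i =>
    (measurable_from_nat.comp (hLm i)).mul hb
  have hk : ∀ i, Measurable (k i) := fun i => by
    refine Measurable.indicator (Measurable.inv ?_) (hDm i)
    have h1 : Measurable fun q : ℕ × ℕ => ((max 1 (q.1 - q.2) : ℕ) : ℝ≥0∞) := measurable_of_countable _
    exact h1.comp ((hLm i).prodMk hs)
  have hupd : ∀ i, Measurable fun ω => update (X ω) i l := fun i =>
    measurable_pi_iff.2 fun j => by
      by_cases hji : j = i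
      · subst hji; simp
      · simpa [hji] using measurable_pi_iff.1 hX j
  have hEm : MeasurableSet {ω | X ω ∈ H ∧ ∀ i ∈ I, a < X ω i} :=
    (hX hH).inter (hX (measurableSet_forall_lt I a))
  have hpt : ∀ ω ∈ {ω | X ω ∈ H ∧ (∀ i ∈ I, a < X ω i) ∧
        ∃ r ≤ M, CrossesAt I a l b s (X ω) r}, 1 ≤
      ∑ i ∈ I, (Ioc a (τ i (update (X ω) i l))).indicator
        (fun _ => k i (update (X ω) i l)) (X ω i) := by
    rintro ω ⟨hωH, hωD, r, hrM, hr⟩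
    refine (one_le_sum_of_crossesAt (hb0 _ hωH) hrM hr).trans (Finset.sum_le_sum fun i hi => ?_)
    split_ifs with hc
    swap
    · exact zero_le
    have hxl : X ω i ≤ l := hc.2.trans (lastCrossing_mul_le hl i _)
    have e1 := hbi i hi _ hxl
    have e2 := hsi i hi _ hxl
    have e3 : L i (update (X ω) i l) = L i (X ω) := lastCrossing_update e1 e2
    rw [indicator_of_mem]
    · simp only [k]
      rw [indicator_of_mem ((hDu i hi _ hc.1 hxl).2 ⟨hωH, hωD⟩), e2, e3]
    · simp only [τ, e3, e1]
      exact hc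
  -- The shift pays for the outside coordinates: from `L ≤ s + w` and `s * b ≤ a` follows `L * b - a
  -- ≤ w * b`, and the weight `1 / w` cancels `w`.
  have hstep : ∀ i ∈ I, ∀ z, ENNReal.ofReal ((τ i z - a) / (l - a)) * k i z ≤
      (D i).indicator (fun z => ENNReal.ofReal (b z / (l - a))) z := by
    intro i hi z
    by_cases hz : z ∈ D i
    swap
    · simp [k, hz]
    simp only [k]
    rw [indicator_of_mem hz, indicator_of_mem hz]
    set w : ℕ := max 1 (L i z - s z) with hw
    have hw0 : (w : ℝ≥0∞) ≠ 0 := by simp; omega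
    rw [← div_eq_mul_inv, ENNReal.div_le_iff hw0 (by simp), ← ENNReal.ofReal_natCast w,
      ← ENNReal.ofReal_mul (by have := hb0 z hz.1; positivity), div_mul_eq_mul_div]
    refine ENNReal.ofReal_le_ofReal ?_
    gcongr
    have h1 : (L i z : ℝ) ≤ s z + w := by
      have : L i z ≤ s z + w := by omega
      exact_mod_cast this
    have h2 := hsb z hz.1
    have h3 := mul_le_mul_of_nonneg_right h1 (hb0 z hz.1)
    simp only [τ]
    linarith
  -- On the event every coordinate in `(a, l]` contributes the same `b / (l - a)`, so the sum is the
  -- number of them times this, at most `ρ`.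
  have hsum : ∀ ω, ∑ i ∈ I, (Ioc a l).indicator (fun _ => (D i).indicator
        (fun z => ENNReal.ofReal (b z / (l - a))) (update (X ω) i l)) (X ω i) ≤
      {ω | X ω ∈ H ∧ ∀ i ∈ I, a < X ω i}.indicator (fun _ => ENNReal.ofReal ρ) ω := by
    intro ω
    have hterm : ∀ i ∈ I, (Ioc a l).indicator (fun _ => (D i).indicator
        (fun z => ENNReal.ofReal (b z / (l - a))) (update (X ω) i l)) (X ω i) =
        if a < X ω i ∧ X ω i ≤ l then {ω | X ω ∈ H ∧ ∀ i ∈ I, a < X ω i}.indicator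
          (fun _ => ENNReal.ofReal (b (X ω) / (l - a))) ω else 0 := by
      intro i hi
      split_ifs with hc
      swap
      · exact indicator_of_notMem (s := Ioc a l) hc _
      rw [indicator_of_mem (show X ω i ∈ Ioc a l from hc)]
      have := hDu i hi _ hc.1 hc.2
      by_cases hω : X ω ∈ H ∧ ∀ i ∈ I, a < X ω i
      · rw [indicator_of_mem (this.2 hω), indicator_of_mem (by exact hω), hbi i hi _ hc.2]
      · rw [indicator_of_notMem (mt this.1 hω), indicator_of_notMem (by exact hω)]
    rw [Finset.sum_congr rfl hterm, ← Finset.sum_filter, Finset.sum_const, nsmul_eq_mul]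
    by_cases hω : X ω ∈ H ∧ ∀ i ∈ I, a < X ω i
    · rw [indicator_of_mem (by exact hω), indicator_of_mem (by exact hω),
        ← ENNReal.ofReal_natCast, ← ENNReal.ofReal_mul (by positivity)]
      refine ENNReal.ofReal_le_ofReal ?_
      rw [← mul_div_assoc, div_le_iff₀ hla]
      exact hρ _ hω.1
    · rw [indicator_of_notMem (by exact hω)]; simp
  have hmeasF : ∀ i, Measurable fun ω => (Ioc a (τ i (update (X ω) i l))).indicator
      (fun _ => k i (update (X ω) i l)) (X ω i) := fun i => by
    have hXi : Measurable fun ω => X ω i := (measurable_pi_apply i).comp hX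
    exact Measurable.indicator (s := {ω | a < X ω i ∧ X ω i ≤ τ i (update (X ω) i l)})
      ((hk i).comp (hupd i)) ((measurableSet_lt measurable_const hXi).inter
        (measurableSet_le hXi ((hτ i).comp (hupd i))))
  have hmeasG : ∀ i, Measurable fun ω => (Ioc a l).indicator (fun _ => (D i).indicator
        (fun z => ENNReal.ofReal (b z / (l - a))) (update (X ω) i l)) (X ω i) := fun i => by
    have hXi : Measurable fun ω => X ω i := (measurable_pi_apply i).comp hX
    refine Measurable.indicator (s := {ω | a < X ω i ∧ X ω i ≤ l}) ?_
      ((measurableSet_lt measurable_const hXi).inter (measurableSet_le hXi measurable_const))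
    exact (Measurable.indicator (hb.div_const _).ennreal_ofReal (hDm i)).comp (hupd i)
  calc P {ω | X ω ∈ H ∧ (∀ i ∈ I, a < X ω i) ∧ ∃ r ≤ M, CrossesAt I a l b s (X ω) r}
      ≤ ∫⁻ ω, ∑ i ∈ I, (Ioc a (τ i (update (X ω) i l))).indicator
        (fun _ => k i (update (X ω) i l)) (X ω i) ∂P :=
        meas_le_lintegral₀ (Finset.measurable_sum _ fun i _ => hmeasF i).aemeasurable hpt
    _ = ∑ i ∈ I, ∫⁻ ω, (Ioc a (τ i (update (X ω) i l))).indicator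
        (fun _ => k i (update (X ω) i l)) (X ω i) ∂P :=
        lintegral_finsetSum _ fun i _ => hmeasF i
    _ ≤ ∑ i ∈ I, ∫⁻ ω, (Ioc a l).indicator (fun _ => (D i).indicator
        (fun z => ENNReal.ofReal (b z / (l - a))) (update (X ω) i l)) (X ω i) ∂P := by
        refine Finset.sum_le_sum fun i hi => ?_
        refine (lintegral_indicator_le_of_indepFun ((measurable_pi_apply i).comp hX) (hupd i)
          (hind i hi) (hu i hi) (hτ i) (lastCrossing_mul_le hl i) (hk i)).trans ?_
        exact lintegral_mono fun ω => indicator_le_indicator (hstep i hi _)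
    _ = ∫⁻ ω, ∑ i ∈ I, (Ioc a l).indicator (fun _ => (D i).indicator
        (fun z => ENNReal.ofReal (b z / (l - a))) (update (X ω) i l)) (X ω i) ∂P :=
        (lintegral_finsetSum _ fun i _ => hmeasG i).symm
    _ ≤ ∫⁻ ω, {ω | X ω ∈ H ∧ ∀ i ∈ I, a < X ω i}.indicator (fun _ => ENNReal.ofReal ρ) ω ∂P :=
        lintegral_mono hsum
    _ = _ := lintegral_indicator_const hEm _

end Crossing

/-! ### From the step-up test to boundary crossing -/

section StepUp

variable {m : ℕ} {α lam : ℝ} {g : (Set.Ici lam → ℝ) → ℝ}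

lemma countLE_eq_card (hm : 1 ≤ m) (x : Fin m → ℝ) (t : ℝ) :
    countLE x t = (Finset.univ.filter fun i => x i ≤ t).card := by
  have : (m : ℝ) ≠ 0 := by positivity
  rw [countLE, empCDF, mul_div_cancel₀ _ this]

lemma filter_le_update {t l : ℝ} (hlt : l ≤ t) {x : Fin m → ℝ} {i : Fin m} (hi : x i ≤ l)
    (J : Finset (Fin m)) :
    (J.filter fun j => update x i l j ≤ t) = J.filter fun j => x j ≤ t := by
  refine Finset.filter_congr fun j _ => ?_
  by_cases hji : j = i
  · subst hji; simp [hlt, hi.trans hlt]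
  · rw [update_of_ne hji]

lemma empCDF_update {t l : ℝ} (hlt : l ≤ t) {x : Fin m → ℝ} {i : Fin m} (hi : x i ≤ l) :
    empCDF (update x i l) t = empCDF x t := by
  rw [empCDF, filter_le_update hlt hi, empCDF]

/-- The estimator reads the empirical distribution function only on `[lam, ∞)`, where moving a point
up to `lam` is invisible. -/
lemma estimate_update {x : Fin m → ℝ} {i : Fin m} (hi : x i ≤ lam) :
    estimate lam g (update x i lam) = estimate lam g x := by
  unfold estimate
  congr 1
  exact funext fun t => empCDF_update t.2 hi

lemma measurable_card_filter_le (J : Finset (Fin m)) (t : ℝ) :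
    Measurable fun x : Fin m → ℝ => (J.filter fun i => x i ≤ t).card := by
  simp only [Finset.card_filter]
  exact Finset.measurable_sum _ fun i _ => Measurable.ite
    (measurableSet_le (measurable_pi_apply i) measurable_const) measurable_const measurable_const

lemma measurable_empCDF (t : ℝ) : Measurable fun x : Fin m → ℝ => empCDF x t :=
  (measurable_from_nat.comp (measurable_card_filter_le Finset.univ t)).div_const _

lemma measurable_estimate (hg : Measurable g) :
    Measurable fun x : Fin m → ℝ => estimate lam g x :=
  hg.comp (measurable_pi_iff.2 fun t => measurable_empCDF t)

/-- At least `r` p-values are at most the `r`-th order statistic. -/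
lemma le_card_of_orderStat_le {x : Fin m → ℝ} {r : ℕ} (hrm : r ≤ m) {c : ℝ}
    (h : orderStat x r ≤ c) : r ≤ (Finset.univ.filter fun i => x i ≤ c).card := by
  rcases Nat.eq_zero_or_pos r with rfl | hr
  · exact Nat.zero_le _
  rw [orderStat, dif_pos ⟨hr, hrm⟩] at h
  let f : Fin r → Fin m := fun j => Tuple.sort x (Fin.castLE hrm j)
  have hf : Injective f := (Tuple.sort x).injective.comp (Fin.castLE_injective hrm)
  calc r = (Finset.univ.image f).card := by simp [Finset.card_image_of_injective _ hf]
    _ ≤ _ := Finset.card_le_card fun i hi => by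
      obtain ⟨j, -, rfl⟩ := Finset.mem_image.1 hi
      refine Finset.mem_filter.2 ⟨Finset.mem_univ _, le_trans ?_ h⟩
      exact Tuple.monotone_sort x (Fin.le_def.2 (by simp; omega))

lemma numRej_le (x : Fin m → ℝ) : numRej α lam g x ≤ m := Nat.findGreatest_le _

lemma orderStat_numRej_le (hlam : 0 ≤ lam) (x : Fin m → ℝ) :
    orderStat x (numRej α lam g x) ≤ critVal α lam g x (numRej α lam g x) := by
  refine Nat.findGreatest_spec (P := fun i => orderStat x i ≤ critVal α lam g x i)
    (Nat.zero_le m) ?_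
  -- Index `0` always qualifies, as both sides are `0`, so the maximum exists.
  simp [orderStat, critVal, hlam]

lemma numFalseRej_mono (x : Fin m → ℝ) {I J : Finset (Fin m)} (h : I ⊆ J) :
    numFalseRej α lam g I x ≤ numFalseRej α lam g J x :=
  Finset.card_le_card (Finset.filter_subset_filter _ h)

lemma fdp_eq_zero {I : Finset (Fin m)} {x : Fin m → ℝ} (h : numFalseRej α lam g I x = 0) :
    fdp α lam g I x = 0 := by
  simp [fdp, h]

lemma fdp_nonneg (I : Finset (Fin m)) (x : Fin m → ℝ) : 0 ≤ fdp α lam g I x := by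
  unfold fdp; positivity

lemma fdr_nonneg {Ω : Type*} [MeasurableSpace Ω] (P : Measure Ω) (p : Fin m → Ω → ℝ)
    (I : Finset (Fin m)) : 0 ≤ fdr P p α lam g I :=
  integral_nonneg fun _ => fdp_nonneg _ _

/-- A rejected hypothesis in `I` forces the linear boundary to be crossed. -/
lemma crossesAt_numRej {I : Finset (Fin m)} {a : ℝ} {x : Fin m → ℝ} (hα : 0 ≤ α)
    (hlam : 0 ≤ lam) (hpos : 0 < estimate lam g x)
    (hn : (Finset.univ.filter fun i => x i ≤ lam).card * (α / estimate lam g x) ≤ lam)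
    (haI : ∀ i ∈ I, a < x i) (hV : numFalseRej α lam g I x ≠ 0) :
    CrossesAt I a lam (fun x => α / estimate lam g x)
      (fun x => (Iᶜ.filter fun i => x i ≤ lam).card) x (numRej α lam g x) := by
  set r := numRej α lam g x with hr
  set b := α / estimate lam g x with hb
  have hb0 : 0 ≤ b := by positivity
  have hcard : r ≤ (Finset.univ.filter fun i => x i ≤ critVal α lam g x r).card :=
    le_card_of_orderStat_le (numRej_le x) (orderStat_numRej_le hlam x)
  have hcl : critVal α lam g x r ≤ lam := min_le_right _ _
  -- All `r` smallest p-values are at most `lam`, so `r ≤ R(lam)`. Hence the cap at `lam` is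
  -- inactive and the critical value is linear in `r`.
  have hrb : (r : ℝ) * b ≤ lam := by
    refine le_trans ?_ hn
    gcongr
    exact hcard.trans (Finset.card_le_card
      (Finset.monotone_filter_right _ fun _ _ hi => hi.trans hcl))
  have hc : critVal α lam g x r = r * b := by
    rw [critVal, div_mul_eq_mul_div, mul_div_assoc]
    exact min_eq_left hrb
  have hVc : numFalseRej α lam g I x = countIoc I a x (r * b) := by
    rw [numFalseRej, ← hr, hc, countIoc]
    congr 1
    exact Finset.filter_congr fun i hi => by simp [haI i hi]
  refine ⟨hrb, ?_, ?_⟩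
  · change 1 ≤ countIoc I a x (r * b)
    omega
  · change r ≤ (Iᶜ.filter fun i => x i ≤ lam).card + countIoc I a x (r * b)
    rw [← hVc, numFalseRej, ← hr]
    calc r ≤ (Finset.univ.filter fun i => x i ≤ critVal α lam g x r).card := hcard
      _ = (Iᶜ.filter fun i => x i ≤ critVal α lam g x r).card +
          (I.filter fun i => x i ≤ critVal α lam g x r).card := by
          rw [← Finset.card_union_of_disjoint
            (Finset.disjoint_filter_filter (disjoint_compl_left)), ← Finset.filter_union]
          congr 2
          ext; simp [em']
      _ ≤ _ := by
          gcongr with i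

/-- The configurations for which the estimator dominates `(C α / lam) (R(lam) ∨ 1)` and the
hypotheses outside `I` shift the rejection boundary by at most `a`. -/
def controlledSet (α lam : ℝ) (g : (Set.Ici lam → ℝ) → ℝ) (C a : ℝ) (I : Finset (Fin m)) :
    Set (Fin m → ℝ) :=
  {x | 0 < estimate lam g x ∧ C * α / lam * max (countLE x lam) 1 ≤ estimate lam g x ∧
    ((Iᶜ.filter fun i => x i ≤ lam).card : ℝ) * (α / estimate lam g x) ≤ a}

lemma measurableSet_controlledSet (hg : Measurable g) (C a : ℝ) (I : Finset (Fin m)) :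
    MeasurableSet (controlledSet α lam g C a I) := by
  have he : Measurable fun x : Fin m → ℝ => estimate lam g x := measurable_estimate hg
  have hc : Measurable fun x : Fin m → ℝ => countLE x lam := (measurable_empCDF lam).const_mul _
  have hs : Measurable fun x : Fin m → ℝ => ((Iᶜ.filter fun i => x i ≤ lam).card : ℝ) :=
    measurable_from_nat.comp (measurable_card_filter_le _ _)
  exact (measurableSet_lt measurable_const he).inter
    ((measurableSet_le ((hc.max measurable_const).const_mul _) he).inter
      (measurableSet_le (hs.mul (he.const_div α)) measurable_const))

lemma update_mem_controlledSet_iff {C a : ℝ} {I : Finset (Fin m)} {x : Fin m → ℝ} {i : Fin m}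
    (hi : x i ≤ lam) :
    update x i lam ∈ controlledSet α lam g C a I ↔ x ∈ controlledSet α lam g C a I := by
  simp only [controlledSet, mem_ofPred_eq, estimate_update hi, filter_le_update le_rfl hi, countLE,
    empCDF_update le_rfl hi]

/-- The assumed lower bound on the estimator enters the crossing argument in this form; the factor
`1 / C` is what makes `ρ < 1` possible. -/
lemma card_mul_le_of_mem_controlledSet (hm : 1 ≤ m) {C a : ℝ} {I : Finset (Fin m)}
    {x : Fin m → ℝ} (hα : 0 < α) (hlam : 0 < lam) (hC : 0 < C)
    (hx : x ∈ controlledSet α lam g C a I) :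
    ((Finset.univ.filter fun i => x i ≤ lam).card : ℝ) * (α / estimate lam g x) ≤ lam / C := by
  obtain ⟨h0, h1, -⟩ := hx
  rw [countLE_eq_card hm] at h1
  set n := ((Finset.univ.filter fun i => x i ≤ lam).card : ℝ)
  rw [mul_div_assoc', div_le_div_iff₀ h0 hC]
  have h2 : C * α / lam * n ≤ estimate lam g x :=
    (mul_le_mul_of_nonneg_left (le_max_left _ _) (by positivity)).trans h1
  rw [div_mul_eq_mul_div, div_le_iff₀ hlam] at h2
  linarith

/-- Lower bound for the probability that no true null is rejected. -/
theorem mul_measureReal_le_measureReal_numFalseRej_eq_zero {Ω : Type*} [MeasurableSpace Ω]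
    {P : Measure Ω} [IsProbabilityMeasure P] (hm : 1 ≤ m) {X : Ω → Fin m → ℝ} (hX : Measurable X)
    {a C ρ : ℝ} (hα : 0 < α) (hlam : 0 < lam) (hg : Measurable g) (ha : 0 ≤ a) (hal : a < lam)
    (hC : 1 < C) (hρ0 : 0 ≤ ρ) (hρ : lam / C ≤ ρ * (lam - a)) {I₀ I : Finset (Fin m)} (hI : I₀ ⊆ I)
    (hind : ∀ i ∈ I, IndepFun (fun ω => X ω i) (fun ω => update (X ω) i lam) P)
    (hu : ∀ i ∈ I, ∀ t, a ≤ t → t ≤ lam → P ((fun ω => X ω i) ⁻¹' Ioc a t) ≤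
      ENNReal.ofReal ((t - a) / (lam - a)) * P ((fun ω => X ω i) ⁻¹' Ioc a lam)) :
    (1 - ρ) * P.real {ω | X ω ∈ controlledSet α lam g C a I ∧ ∀ i ∈ I, a < X ω i} ≤
      P.real {ω | numFalseRej α lam g I₀ (X ω) = 0} := by
  have hC0 : 0 < C := by linarith
  set b : (Fin m → ℝ) → ℝ := fun x => α / estimate lam g x with hb
  set s : (Fin m → ℝ) → ℕ := fun x => (Iᶜ.filter fun i => x i ≤ lam).card with hs
  have hcr := measure_crossing_le (P := P) (b := b) (s := s)
    (H := controlledSet α lam g C a I) (I := I) (ρ := ρ) hX hal ha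
    ((measurable_estimate hg).const_div α) (measurable_card_filter_le _ _)
    (measurableSet_controlledSet hg C a I)
    (fun i _ x hx => by simp only [hb, estimate_update hx])
    (fun i _ x hx => by simp only [hs, filter_le_update le_rfl hx])
    (fun i _ x hx => update_mem_controlledSet_iff hx) hind hu
    (fun x hx => div_nonneg hα.le hx.1.le) (fun x hx => hx.2.2)
    (fun x hx => by
      refine le_trans ?_ ((card_mul_le_of_mem_controlledSet hm hα hlam hC0 hx).trans hρ)
      have : 0 ≤ b x := div_nonneg hα.le hx.1.le
      change (countIoc I a x lam : ℝ) * b x ≤ _ * b x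
      gcongr
      exact Finset.card_le_card fun i hi => by simp_all) m
  set E := {ω | X ω ∈ controlledSet α lam g C a I ∧ ∀ i ∈ I, a < X ω i}
  set B := {ω | X ω ∈ controlledSet α lam g C a I ∧ (∀ i ∈ I, a < X ω i) ∧
    ∃ r ≤ m, CrossesAt I a lam b s (X ω) r}
  have hB : P.real B ≤ ρ * P.real E := by
    have := ENNReal.toReal_mono (by finiteness) hcr
    rwa [ENNReal.toReal_mul, ENNReal.toReal_ofReal hρ0] at this
  -- On `E`, a false rejection is a crossing, and `P(B) ≤ ρ P(E)`; so at least `(1 - ρ) P(E)` is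
  -- left for no false rejection.
  have hsub : E ⊆ {ω | numFalseRej α lam g I₀ (X ω) = 0} ∪ B := by
    rintro ω ⟨h1, h2⟩
    by_cases hV : numFalseRej α lam g I₀ (X ω) = 0
    · exact Or.inl hV
    refine Or.inr ⟨h1, h2, numRej α lam g (X ω), numRej_le _, ?_⟩
    refine crossesAt_numRej hα.le hlam.le h1.1 ?_ h2 ?_
    · exact (card_mul_le_of_mem_controlledSet hm hα hlam hC0 h1).trans (div_le_self hlam.le hC.le)
    · have := numFalseRej_mono (α := α) (lam := lam) (g := g) (X ω) hI
      omega
  have h1 := (measureReal_mono hsub).trans (measureReal_union_le (μ := P) _ _)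
  linarith

end StepUp

/-! ### Independence of one coordinate from the remaining ones -/

section Independence

variable {Ω : Type*} [MeasurableSpace Ω] {P : Measure Ω} [IsProbabilityMeasure P]

/-- The joint law of the triple is the full product of the three laws, and products of measures are
associative. -/
lemma IndepFun.prodMk_right_of_prodMk_left {β γ δ : Type*} [MeasurableSpace β] [MeasurableSpace γ]
    [MeasurableSpace δ] {A : Ω → β} {B : Ω → γ} {Y : Ω → δ} (hA : Measurable A) (hB : Measurable B)
    (hY : Measurable Y) (hAB : IndepFun A B P) (h : IndepFun (fun ω => (A ω, B ω)) Y P) :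
    IndepFun A (fun ω => (B ω, Y ω)) P := by
  have hBY : IndepFun B Y P := h.comp measurable_snd measurable_id
  have : IsProbabilityMeasure (P.map A) := Measure.isProbabilityMeasure_map hA.aemeasurable
  have : IsProbabilityMeasure (P.map B) := Measure.isProbabilityMeasure_map hB.aemeasurable
  have : IsProbabilityMeasure (P.map Y) := Measure.isProbabilityMeasure_map hY.aemeasurable
  rw [indepFun_iff_map_prod_eq_prod_map_map hA.aemeasurable (hB.prodMk hY).aemeasurable]
  rw [indepFun_iff_map_prod_eq_prod_map_map (hA.prodMk hB).aemeasurable hY.aemeasurable] at h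
  rw [indepFun_iff_map_prod_eq_prod_map_map hA.aemeasurable hB.aemeasurable] at hAB
  rw [indepFun_iff_map_prod_eq_prod_map_map hB.aemeasurable hY.aemeasurable] at hBY
  rw [hBY, ← Measure.prodAssoc_prod, ← hAB, ← h,
    Measure.map_map MeasurableEquiv.prodAssoc.measurable ((hA.prodMk hB).prodMk hY)]
  rfl

/-- A coordinate of an independent block is independent of all other coordinates, provided the
block is independent of the rest. -/
lemma indepFun_update {ι : Type*} [DecidableEq ι] {p : ι → Ω → ℝ} (hp : ∀ i, Measurable (p i))
    {J K : Finset ι} (hJK : ∀ i, i ∈ J ∨ i ∈ K)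
    (hblock : IndepFun (fun ω (i : {i // i ∈ J}) => p i ω) (fun ω (i : {i // i ∈ K}) => p i ω) P)
    (hJ : iIndepFun (fun (i : {i // i ∈ J}) => p i) P) {i : ι} (hi : i ∈ J) (c : ℝ) :
    IndepFun (p i) (fun ω => update (fun j => p j ω) i c) P := by
  let i₀ : {i // i ∈ J} := ⟨i, hi⟩
  let T : Finset {i // i ∈ J} := Finset.univ.erase i₀
  let B : Ω → T → ℝ := fun ω j => p j.1 ω
  let Y : Ω → {i // i ∈ K} → ℝ := fun ω j => p j ω
  have hB : Measurable B := measurable_pi_iff.2 fun j => hp _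
  have hY : Measurable Y := measurable_pi_iff.2 fun j => hp _
  have hAB : IndepFun (p i) B P :=
    (hJ.indepFun_finset {i₀} T (by simp [T]) fun j => hp _).comp
      (φ := fun v : ({i₀} : Finset {i // i ∈ J}) → ℝ => v ⟨i₀, Finset.mem_singleton_self _⟩)
      (ψ := id) (measurable_pi_apply _) measurable_id
  have hABY : IndepFun (fun ω => (p i ω, B ω)) Y P :=
    hblock.comp (φ := fun v : {i // i ∈ J} → ℝ => (v i₀, fun j : T => v j.1)) (ψ := id)
      ((measurable_pi_apply _).prodMk (measurable_pi_iff.2 fun j => measurable_pi_apply _))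
      measurable_id
  have h := IndepFun.prodMk_right_of_prodMk_left (hp i) hB hY hAB hABY
  let φ : (T → ℝ) × ({i // i ∈ K} → ℝ) → ι → ℝ := fun q j =>
    if hj : j = i then c else if hJj : j ∈ J then
      q.1 ⟨⟨j, hJj⟩, Finset.mem_erase.2 ⟨fun h => hj (congrArg Subtype.val h), Finset.mem_univ _⟩⟩
    else q.2 ⟨j, (hJK j).resolve_left hJj⟩
  have hφ : Measurable φ := measurable_pi_iff.2 fun j => by
    simp only [φ]
    split_ifs
    · exact measurable_const
    · exact (measurable_pi_apply _).comp measurable_fst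
    · exact (measurable_pi_apply _).comp measurable_snd
  have e : (fun ω => update (fun j => p j ω) i c) = φ ∘ fun ω => (B ω, Y ω) := by
    ext ω j
    simp only [φ, comp_apply, update_apply]
    split_ifs <;> rfl
  rw [e]
  exact h.comp measurable_id hφ

end Independence

/-! ### Estimates for uniform p-values -/

section Uniform

variable {Ω : Type*} [MeasurableSpace Ω] {P : Measure Ω}

lemma measure_preimage_Ioc_of_isUniform {X : Ω → ℝ} {u : ℝ} (hu : 0 < u)
    (hX : pdf.IsUniform X (Icc 0 u) P volume) {a t : ℝ} (ha : 0 ≤ a) (ht : t ≤ u) :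
    P (X ⁻¹' Ioc a t) = ENNReal.ofReal ((t - a) / u) := by
  rw [hX.measure_preimage (by simp [hu]) (by simp) measurableSet_Ioc,
    inter_eq_right.2 (Ioc_subset_Icc_self.trans (Icc_subset_Icc ha ht)), Real.volume_Ioc,
    Real.volume_Icc, sub_zero, ENNReal.ofReal_div_of_pos hu]

/-- A uniform variable stays uniform when conditioned to `(a, l]`. The cases `u = 1` and `u = lam`
cover true nulls and the false nulls of (b). -/
lemma measure_preimage_Ioc_le_of_isUniform {X : Ω → ℝ} {u : ℝ} (hu : 0 < u)
    (hX : pdf.IsUniform X (Icc 0 u) P volume) {a l t : ℝ} (ha : 0 ≤ a) (hal : a < l) (hl : l ≤ u)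
    (hat : a ≤ t) (ht : t ≤ l) :
    P (X ⁻¹' Ioc a t) ≤ ENNReal.ofReal ((t - a) / (l - a)) * P (X ⁻¹' Ioc a l) := by
  have hla : 0 < l - a := sub_pos.2 hal
  rw [measure_preimage_Ioc_of_isUniform hu hX ha (ht.trans hl),
    measure_preimage_Ioc_of_isUniform hu hX ha hl, ← ENNReal.ofReal_mul
      (div_nonneg (sub_nonneg.2 hat) hla.le), div_mul_div_cancel₀ hla.ne']

lemma ae_pos_of_isUniform {X : Ω → ℝ} {u : ℝ} (hu : 0 < u)
    (hX : pdf.IsUniform X (Icc 0 u) P volume) : ∀ᵐ ω ∂P, 0 < X ω := by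
  rw [ae_iff]
  have h : {ω | ¬ 0 < X ω} = X ⁻¹' Iic 0 := by ext; simp
  rw [h, hX.measure_preimage (by simp [hu]) (by simp) measurableSet_Iic]
  have h2 : Icc 0 u ∩ Iic 0 = {(0 : ℝ)} := by
    ext x
    simp only [mem_inter_iff, mem_Icc, mem_Iic, mem_singleton_iff]
    exact ⟨fun h => le_antisymm h.2 h.1.1, fun h => by simp [h, hu.le]⟩
  simp [h2]

lemma measure_preimage_Ioi_of_isUniform {X : Ω → ℝ}
    (hX : pdf.IsUniform X (Icc 0 1) P volume) {a : ℝ} (ha : 0 ≤ a) :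
    P (X ⁻¹' Ioi a) = ENNReal.ofReal (1 - a) := by
  rw [hX.measure_preimage (by simp) (by simp) measurableSet_Ioi]
  have h2 : Icc 0 1 ∩ Ioi a = Ioc a 1 := by
    ext x
    simp only [mem_inter_iff, mem_Icc, mem_Ioi, mem_Ioc]
    exact ⟨fun h => ⟨h.2, h.1.2⟩, fun h => ⟨⟨ha.trans h.1.le, h.2⟩, h.1⟩⟩
  simp [h2]

variable {ι : Type*} {p : ι → Ω → ℝ} {I : Finset ι}

lemma measure_forall_lt_of_isUniform (hind : iIndepFun (fun (i : {i // i ∈ I}) => p i) P)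
    (hu : ∀ i ∈ I, pdf.IsUniform (p i) (Icc 0 1) P volume) {c : ι → ℝ} (hc : ∀ i, 0 ≤ c i) :
    P {ω | ∀ i ∈ I, c i < p i ω} = ∏ i ∈ I, ENNReal.ofReal (1 - c i) := by
  have h := hind.measure_inter_preimage_eq_mul Finset.univ
    (sets := fun i => Ioi (c i)) fun i _ => measurableSet_Ioi
  have e : {ω | ∀ i ∈ I, c i < p i ω} =
      ⋂ i ∈ (Finset.univ : Finset {i // i ∈ I}), p i ⁻¹' Ioi (c i) := by ext; simp
  rw [e, h, ← Finset.prod_coe_sort I]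
  exact Finset.prod_congr rfl fun i _ => measure_preimage_Ioi_of_isUniform (hu i i.2) (hc i)

/-- Given that no uniform variable is below `a`, it is unlikely that few of them are below `l`. -/
lemma measureReal_card_lt_le [DecidableEq ι] (hp : ∀ i, Measurable (p i))
    (hind : iIndepFun (fun (i : {i // i ∈ I}) => p i) P)
    (hu : ∀ i ∈ I, pdf.IsUniform (p i) (Icc 0 1) P volume) (hI : I.Nonempty) {a l η : ℝ}
    (ha : 0 ≤ a) (hal : a ≤ l) (hl : l ≤ 1) (hη : η ≤ 1) :
    (1 - η) * (1 - a) * P.real {ω | (∀ i ∈ I, a < p i ω) ∧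
      ((I.filter fun i => p i ω ≤ l).card : ℝ) < η * I.card} ≤ (1 - l) * (1 - a) ^ I.card := by
  set M := (I.card : ℝ) with hM
  have hM0 : 0 < M := Nat.cast_pos.2 hI.card_pos
  have ha1 : 0 ≤ 1 - a := by linarith
  -- When all variables exceed `a`, this counts those above `l`. Its mean is explicit by
  -- independence, and Markov's inequality at level `(1 - η) * M` gives the claim.
  set f : Ω → ℝ≥0∞ := fun ω => ∑ i ∈ I,
    {ω | ∀ j ∈ I, update (fun _ => a) i l j < p j ω}.indicator 1 ω with hf
  have hmeas : ∀ i, MeasurableSet {ω | ∀ j ∈ I, update (fun _ => a) i l j < p j ω} := fun i => by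
    have e : {ω | ∀ j ∈ I, update (fun _ => a) i l j < p j ω} =
      ⋂ j ∈ I, p j ⁻¹' Ioi (update (fun _ => a) i l j) := by ext; simp
    rw [e]
    exact Finset.measurableSet_biInter _ fun j _ => hp j measurableSet_Ioi
  have hint : ∫⁻ ω, f ω ∂P = ENNReal.ofReal (M * ((1 - l) * (1 - a) ^ (I.card - 1))) := by
    rw [hf, lintegral_finsetSum _ fun i _ => measurable_one.indicator (hmeas i)]
    have : ∀ i ∈ I, ∫⁻ ω, {ω | ∀ j ∈ I, update (fun _ => a) i l j < p j ω}.indicator 1 ω ∂P =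
        ENNReal.ofReal ((1 - l) * (1 - a) ^ (I.card - 1)) := fun i hi => by
      rw [lintegral_indicator_one (hmeas i), measure_forall_lt_of_isUniform hind hu fun j => by
          by_cases hji : j = i
          · subst hji; simp [ha.trans hal]
          · simp [hji, ha],
        ← Finset.mul_prod_erase _ _ hi, update_self,
        Finset.prod_congr rfl fun j hj => by rw [update_of_ne (Finset.ne_of_mem_erase hj)],
        Finset.prod_const, Finset.card_erase_of_mem hi, ENNReal.ofReal_mul (by linarith),
        ENNReal.ofReal_pow ha1]
    rw [Finset.sum_congr rfl this, Finset.sum_const, nsmul_eq_mul, ENNReal.ofReal_mul hM0.le, hM,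
      ENNReal.ofReal_natCast]
  set S := {ω | (∀ i ∈ I, a < p i ω) ∧ ((I.filter fun i => p i ω ≤ l).card : ℝ) < η * M}
  have hS : S ⊆ {ω | ENNReal.ofReal ((1 - η) * M) ≤ f ω} := by
    rintro ω ⟨h1, h2⟩
    have h3 : f ω = ((I.filter fun i => ¬ p i ω ≤ l).card : ℝ≥0∞) := by
      rw [hf, Finset.card_filter, Nat.cast_sum]
      refine Finset.sum_congr rfl fun i hi => ?_
      have : (∀ j ∈ I, update (fun _ => a) i l j < p j ω) ↔ ¬ p i ω ≤ l := by
        rw [not_le]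
        refine ⟨fun h => by simpa using h i hi, fun h j hj => ?_⟩
        by_cases hji : j = i
        · subst hji; simpa using h
        · simpa [hji] using h1 j hj
      rw [indicator_apply]
      simp only [mem_ofPred_eq]
      split_ifs with h5 h6 h6
      · exact absurd h6 (this.1 h5)
      · simp
      · simp
      · exact absurd (this.2 h6) h5
    have h4 : ((I.filter fun i => p i ω ≤ l).card : ℝ) + (I.filter fun i => ¬ p i ω ≤ l).card = M := by
      rw [hM]
      exact_mod_cast Finset.card_filter_add_card_filter_not _
    change ENNReal.ofReal ((1 - η) * M) ≤ f ω
    rw [h3, ← ENNReal.ofReal_natCast]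
    exact ENNReal.ofReal_le_ofReal (by linarith)
  have hmarkov : ENNReal.ofReal ((1 - η) * M) * P S ≤
      ENNReal.ofReal (M * ((1 - l) * (1 - a) ^ (I.card - 1))) := by
    rw [← hint]
    refine (mul_le_mul_right (measure_mono hS) _).trans (mul_meas_ge_le_lintegral ?_ _)
    exact Finset.measurable_sum _ fun i _ => measurable_one.indicator (hmeas i)
  have hreal : (1 - η) * M * P.real S ≤ M * ((1 - l) * (1 - a) ^ (I.card - 1)) := by
    have h := ENNReal.toReal_mono ENNReal.ofReal_ne_top hmarkov
    have hl1 : 0 ≤ 1 - l := by linarith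
    rwa [ENNReal.toReal_mul, ENNReal.toReal_ofReal (mul_nonneg (by linarith) hM0.le),
      ENNReal.toReal_ofReal (by positivity)] at h
  have hcan : (1 - η) * P.real S ≤ (1 - l) * (1 - a) ^ (I.card - 1) := by
    refine le_of_mul_le_mul_left ?_ hM0
    linarith
  calc (1 - η) * (1 - a) * P.real S = (1 - η) * P.real S * (1 - a) := by ring
    _ ≤ (1 - l) * (1 - a) ^ (I.card - 1) * (1 - a) := by gcongr
    _ = (1 - l) * (1 - a) ^ I.card := by
      rw [mul_assoc, pow_sub_one_mul hI.card_pos.ne']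

variable [IsProbabilityMeasure P]

/-- With probability bounded below, no uniform variable is below `a` and many are below `l`. -/
lemma mul_pow_le_measureReal_card_ge [DecidableEq ι] (hp : ∀ i, Measurable (p i))
    (hind : iIndepFun (fun (i : {i // i ∈ I}) => p i) P)
    (hu : ∀ i ∈ I, pdf.IsUniform (p i) (Icc 0 1) P volume) (hI : I.Nonempty) {a l η θ : ℝ}
    (ha : 0 ≤ a) (hal : a < l) (hl : l ≤ 1) (hη : η < 1)
    (hθ : 1 - l ≤ θ * ((1 - η) * (1 - a))) :
    (1 - θ) * (1 - a) ^ I.card ≤ P.real {ω | (∀ i ∈ I, a < p i ω) ∧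
      η * I.card ≤ ((I.filter fun i => p i ω ≤ l).card : ℝ)} := by
  have ha1 : 0 < 1 - a := by linarith
  have h1 := measureReal_card_lt_le hp hind hu hI ha hal.le hl hη.le
  set S := {ω | (∀ i ∈ I, a < p i ω) ∧ ((I.filter fun i => p i ω ≤ l).card : ℝ) < η * I.card}
  set T := {ω | (∀ i ∈ I, a < p i ω) ∧ η * I.card ≤ ((I.filter fun i => p i ω ≤ l).card : ℝ)}
  have hpos : 0 < (1 - η) * (1 - a) := mul_pos (by linarith) ha1
  have h2 : P.real S ≤ θ * (1 - a) ^ I.card := by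
    refine le_of_mul_le_mul_left ?_ hpos
    calc _ ≤ _ := h1
      _ ≤ θ * ((1 - η) * (1 - a)) * (1 - a) ^ I.card := by gcongr
      _ = _ := by ring
  have h3 : P.real {ω | ∀ i ∈ I, a < p i ω} = (1 - a) ^ I.card := by
    rw [measureReal_def, measure_forall_lt_of_isUniform hind hu fun _ => ha, Finset.prod_const,
      ENNReal.toReal_pow, ENNReal.toReal_ofReal ha1.le]
  have h4 : {ω | ∀ i ∈ I, a < p i ω} ⊆ S ∪ T := fun ω hω => by
    rcases lt_or_ge ((I.filter fun i => p i ω ≤ l).card : ℝ) (η * I.card) with h | h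
    · exact Or.inl ⟨hω, h⟩
    · exact Or.inr ⟨hω, h⟩
  have h5 := (measureReal_mono (μ := P) h4).trans (measureReal_union_le _ _)
  linarith

end Uniform

/-! ### Lower bounds for the probability of no false rejection -/

section Asymptotics

/-- Under consistency and a nonvanishing false discovery rate, false rejections occur with
probability tending to one. -/
lemma Consistent.eventually_measureReal_numFalseRej_eq_zero_lt {Ω : ℕ → Type*}
    [∀ m, MeasurableSpace (Ω m)] {P : ∀ m, Measure (Ω m)} [∀ m, IsProbabilityMeasure (P m)]
    {p : ∀ m, Fin m → Ω m → ℝ} {α lam : ℝ} {g : ℕ → (Set.Ici lam → ℝ) → ℝ}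
    {I₀ : ∀ m, Finset (Fin m)} (h : Consistent P p α lam g I₀)
    (hFDR : 0 < liminf (fun m => fdr (P m) (p m) α lam (g m) (I₀ m)) atTop) {ε : ℝ} (hε : 0 < ε) :
    ∀ᶠ m in atTop, (P m).real {ω | numFalseRej α lam (g m) (I₀ m) (fun i => p m i ω) = 0} < ε := by
  obtain ⟨δ, hδ0, hδ⟩ := exists_between hFDR
  have hev : ∀ᶠ m in atTop, δ < fdr (P m) (p m) α lam (g m) (I₀ m) :=
    eventually_lt_of_lt_liminf hδ
      (isBoundedUnder_of ⟨0, fun m => fdr_nonneg (P m) (p m) (I₀ m)⟩)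
  have hlt := (h δ hδ0).eventually_lt_const (ENNReal.ofReal_pos.2 hε)
  filter_upwards [hev, hlt] with m h1 h2
  have hsub : {ω | numFalseRej α lam (g m) (I₀ m) (fun i => p m i ω) = 0} ⊆ {ω | δ ≤
      |fdp α lam (g m) (I₀ m) (fun i => p m i ω) - fdr (P m) (p m) α lam (g m) (I₀ m)|} := by
    intro ω hω
    rw [mem_ofPred_eq, fdp_eq_zero hω, zero_sub, abs_neg]
    exact h1.le.trans (le_abs_self _)
  rw [measureReal_def]
  exact (ENNReal.lt_ofReal_iff_toReal_lt (by finiteness)).1 ((measure_mono hsub).trans_lt h2)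

lemma add_sub_one_le_measureReal_inter {Ω : Type*} [MeasurableSpace Ω] {P : Measure Ω}
    [IsProbabilityMeasure P] (S : Set Ω) {T : Set Ω} (hT : MeasurableSet T) :
    P.real S + P.real T - 1 ≤ P.real (S ∩ T) := by
  have h1 := measureReal_union_add_inter (μ := P) (s := S) hT
  have h2 : P.real (S ∪ T) ≤ 1 := measureReal_le_one
  linarith

/-- As the shift `2k / n` tends to `0`, each bound holds with room to spare: `(1 + 1 / C) / 2` lies
strictly between `1 / C` and `1`, `1 - 3 * lam / 4` strictly between `1 - lam` and `1 - lam / 2`,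
and the power tends to `exp (-2k)`. -/
lemma eventually_shift_bounds {lam C k : ℝ} (hlam0 : 0 < lam) (hlam : lam < 1) (hC : 1 < C) :
    ∀ᶠ n : ℕ in atTop, 2 * k / n < lam ∧ lam / C ≤ (1 + 1 / C) / 2 * (lam - 2 * k / n) ∧
      1 - lam ≤ (1 - lam) / (1 - 3 * lam / 4) * ((1 - lam / 2) * (1 - 2 * k / n)) ∧
      Real.exp (-(2 * k)) / 2 ≤ (1 - 2 * k / n) ^ n := by
  have ha : Tendsto (fun n : ℕ => 2 * k / (n : ℝ)) atTop (𝓝 0) :=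
    tendsto_const_div_atTop_nhds_zero_nat _
  have hC0 : 0 < C := by linarith
  have h1 := ha.eventually_lt_const hlam0
  have h2 : ∀ᶠ n : ℕ in atTop, lam / C < (1 + 1 / C) / 2 * (lam - 2 * k / n) := by
    have : Tendsto (fun n : ℕ => (1 + 1 / C) / 2 * (lam - 2 * k / n)) atTop
        (𝓝 ((1 + 1 / C) / 2 * (lam - 0))) := (tendsto_const_nhds.sub ha).const_mul _
    refine this.eventually_const_lt ?_
    have h : 1 / C < 1 := (div_lt_one hC0).2 hC
    rw [sub_zero, div_eq_mul_one_div lam C, mul_comm lam]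
    exact mul_lt_mul_of_pos_right (by linarith) hlam0
  have h3 : ∀ᶠ n : ℕ in atTop, 1 - 3 * lam / 4 < (1 - lam / 2) * (1 - 2 * k / n) := by
    have : Tendsto (fun n : ℕ => (1 - lam / 2) * (1 - 2 * k / n)) atTop
        (𝓝 ((1 - lam / 2) * (1 - 0))) := (tendsto_const_nhds.sub ha).const_mul _
    exact this.eventually_const_lt (by linarith)
  have h4 : ∀ᶠ n : ℕ in atTop, Real.exp (-(2 * k)) / 2 < (1 + -(2 * k) / n) ^ n :=
    (Real.tendsto_one_add_div_pow_exp (-(2 * k))).eventually_const_lt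
      (half_lt_self (Real.exp_pos _))
  filter_upwards [h1, h2, h3, h4] with n h1 h2 h3 h4
  refine ⟨h1, h2.le, ?_, ?_⟩
  · have hpos : 0 < 1 - 3 * lam / 4 := by linarith
    rw [div_mul_eq_mul_div, le_div_iff₀ hpos]
    exact mul_le_mul_of_nonneg_left h3.le (by linarith)
  · rw [neg_div, ← sub_eq_add_neg] at h4
    exact h4.le

variable {Ω : Type*} [MeasurableSpace Ω] {P : Measure Ω} [IsProbabilityMeasure P] {m : ℕ}
  {p : Fin m → Ω → ℝ} {I₀ : Finset (Fin m)} {α lam C : ℝ} {g : (Set.Ici lam → ℝ) → ℝ}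

lemma measurableSet_le_estimate {X : Ω → Fin m → ℝ} (hX : Measurable X) (hg : Measurable g) :
    MeasurableSet {ω | C * α / lam * max (countLE (X ω) lam) 1 ≤ estimate lam g (X ω)} :=
  measurableSet_le ((((measurable_empCDF lam).const_mul _).comp hX).max measurable_const
    |>.const_mul _) ((measurable_estimate hg).comp hX)

/-- With few false nulls, the probability of no false rejection is bounded below. -/
lemma BasicIndependence.le_measureReal_numFalseRej_eq_zero (h : BasicIndependence P p I₀)
    (hm : 1 ≤ m) (hI₀ : 1 ≤ I₀.card) (hα : 0 < α) (hlam0 : 0 < lam) (hlam : lam < 1)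
    (hg : Measurable g) (hpos : ∀ ω, 0 < estimate lam g fun i => p i ω) (hC : 1 < C) {k : ℕ}
    (hk : I₀ᶜ.card ≤ k) {ρ θ : ℝ} (hρ0 : 0 ≤ ρ) (hρ1 : ρ ≤ 1)
    (hal : 2 * k / (I₀.card : ℝ) < lam) (hρ : lam / C ≤ ρ * (lam - 2 * k / (I₀.card : ℝ)))
    (hθ : 1 - lam ≤ θ * ((1 - lam / 2) * (1 - 2 * k / (I₀.card : ℝ)))) :
    (1 - ρ) * ((1 - θ) * (1 - 2 * k / (I₀.card : ℝ)) ^ I₀.card +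
      P.real {ω | C * α / lam * max (countLE (fun i => p i ω) lam) 1 ≤
        estimate lam g (fun i => p i ω)} - 1) ≤
      P.real {ω | numFalseRej α lam g I₀ (fun i => p i ω) = 0} := by
  set a : ℝ := 2 * k / I₀.card with ha
  have ha0 : 0 ≤ a := by positivity
  have hM : (0 : ℝ) < I₀.card := by exact_mod_cast hI₀
  have hX : Measurable fun ω i => p i ω := measurable_pi_iff.2 h.measurable
  have hmain := mul_measureReal_le_measureReal_numFalseRej_eq_zero (P := P) hm hX hα hlam0 hg ha0
    hal hC hρ0 hρ (Finset.Subset.refl I₀)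
    (fun i hi => indepFun_update h.measurable (J := I₀) (K := I₀ᶜ)
      (fun j => by simp [em]) h.indep_true_false h.indep_true hi lam)
    (fun i hi t hat ht => measure_preimage_Ioc_le_of_isUniform one_pos (h.uniform_true i hi) ha0 hal
      hlam.le hat ht)
  refine le_trans (mul_le_mul_of_nonneg_left ?_ (sub_nonneg.2 hρ1)) hmain
  have hT := mul_pow_le_measureReal_card_ge (P := P) h.measurable h.indep_true h.uniform_true
    (Finset.card_pos.1 hI₀) ha0 hal hlam.le (η := lam / 2) (by linarith) hθ
  set T := {ω | (∀ i ∈ I₀, a < p i ω) ∧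
    lam / 2 * I₀.card ≤ ((I₀.filter fun i => p i ω ≤ lam).card : ℝ)}
  have hint := add_sub_one_le_measureReal_inter (P := P) T
    (measurableSet_le_estimate (C := C) (α := α) hX hg)
  refine le_trans (by linarith) (hint.trans (measureReal_mono ?_))
  rintro ω ⟨⟨h1, h2⟩, h3⟩
  refine ⟨⟨hpos ω, h3, ?_⟩, h1⟩
  have he := hpos ω
  set e := estimate lam g fun i => p i ω
  -- Having `lam * m₀ / 2` p-values below `lam` forces `m̂₀ ≥ α * m₀ / 2`, so `k` false nulls shift
  -- the boundary by at most `2k / m₀`; hence this choice of `a`.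
  have h4 : lam / 2 * (I₀.card : ℝ) ≤ countLE (fun i => p i ω) lam := by
    rw [countLE_eq_card hm]
    exact h2.trans (by gcongr; exact Finset.subset_univ _)
  have h5 : C * α / lam * (lam / 2 * I₀.card) ≤ e :=
    le_trans (by gcongr; exact h4.trans (le_max_left _ _)) h3
  have h6 : C * α * I₀.card / 2 ≤ e := by
    refine le_trans (le_of_eq ?_) h5
    field_simp
  have h7 : α * I₀.card / 2 ≤ e := by
    refine le_trans ?_ h6
    have : 1 * (α * I₀.card) ≤ C * (α * I₀.card) := by gcongr
    linarith
  have h8 : ((I₀ᶜ.filter fun i => p i ω ≤ lam).card : ℝ) ≤ k := by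
    exact_mod_cast (Finset.card_filter_le _ _).trans hk
  calc ((I₀ᶜ.filter fun i => p i ω ≤ lam).card : ℝ) * (α / e) ≤ k * (α / e) := by gcongr
    _ ≤ a := by
      rw [ha, mul_div_assoc', div_le_div_iff₀ he hM]
      have := mul_le_mul_of_nonneg_left h7 (Nat.cast_nonneg (α := ℝ) k)
      linarith

/-- With uniform false nulls on `[0, lam]`, no null at all is rejected with probability at least
`1 - 1 / C`, up to the failure probability of the bound on the estimator. -/
lemma BasicIndependence.le_measureReal_numFalseRej_eq_zero_of_uniform
    (h : BasicIndependence P p I₀) (hm : 1 ≤ m) (hα : 0 < α) (hlam0 : 0 < lam) (hlam : lam < 1)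
    (hg : Measurable g) (hpos : ∀ ω, 0 < estimate lam g fun i => p i ω) (hC : 1 < C)
    (hind : iIndepFun (fun (i : {i // i ∈ I₀ᶜ}) => p i) P)
    (hu : ∀ i ∈ I₀ᶜ, pdf.IsUniform (p i) (Set.Icc 0 lam) P volume) :
    (1 - 1 / C) * P.real {ω | C * α / lam * max (countLE (fun i => p i ω) lam) 1 ≤
        estimate lam g (fun i => p i ω)} ≤
      P.real {ω | numFalseRej α lam g I₀ (fun i => p i ω) = 0} := by
  have hC0 : 0 < C := by linarith
  have hX : Measurable fun ω i => p i ω := measurable_pi_iff.2 h.measurable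
  have hmain := mul_measureReal_le_measureReal_numFalseRej_eq_zero (P := P) (ρ := 1 / C) hm hX hα
    hlam0 hg le_rfl hlam0 hC (by positivity) (by rw [sub_zero]; exact le_of_eq (by ring))
    (Finset.subset_univ I₀)
    (fun i _ => by
      by_cases hi : i ∈ I₀
      · exact indepFun_update h.measurable (J := I₀) (K := I₀ᶜ)
          (fun j => by simp [em]) h.indep_true_false h.indep_true hi lam
      · exact indepFun_update h.measurable (J := I₀ᶜ) (K := I₀)
          (fun j => by simp [em']) h.indep_true_false.symm hind (Finset.mem_compl.2 hi) lam)
    (fun i _ t hat ht => by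
      by_cases hi : i ∈ I₀
      · exact measure_preimage_Ioc_le_of_isUniform one_pos (h.uniform_true i hi) le_rfl hlam0
          hlam.le hat ht
      · exact measure_preimage_Ioc_le_of_isUniform hlam0 (hu i (Finset.mem_compl.2 hi)) le_rfl
          hlam0 le_rfl hat ht)
  refine le_trans (mul_le_mul_of_nonneg_left ?_ ?_) hmain
  -- With `a = 0` and nothing outside `I`, the controlled event is the estimator bound up to a null
  -- set.
  · have hae : ∀ᵐ ω ∂P, ∀ i, 0 < p i ω := ae_all_iff.2 fun i => by
      by_cases hi : i ∈ I₀
      · exact ae_pos_of_isUniform one_pos (h.uniform_true i hi)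
      · exact ae_pos_of_isUniform hlam0 (hu i (Finset.mem_compl.2 hi))
    refine ENNReal.toReal_mono (by finiteness) (measure_mono_ae ?_)
    filter_upwards [hae] with ω hω h3
    exact ⟨⟨hpos ω, h3, by simp⟩, fun i _ => hω i⟩
  · exact sub_nonneg.2 ((div_le_one hC0).2 hC.le)

end Asymptotics

end AdaptiveStepUp

theorem theorem5p1 {Ω : ℕ → Type*} [∀ m, MeasurableSpace (Ω m)]
    (P : ∀ m, Measure (Ω m)) [∀ m, IsProbabilityMeasure (P m)]
    (p : ∀ m, Fin m → Ω m → ℝ) (I₀ : ∀ m, Finset (Fin m))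
    (hBI : ∀ m, 1 ≤ m → BasicIndependence (P m) (p m) (I₀ m))
    (hm₀ : ∀ m, 1 ≤ m → 1 ≤ (I₀ m).card)
    (α lam : ℝ) (hα₀ : 0 < α) (hα₁ : α < 1) (hαlam : α ≤ lam) (hlam : lam < 1)
    (g : ℕ → (Set.Ici lam → ℝ) → ℝ)
    (hg : ∀ m, 1 ≤ m → Measurable (g m))
    (hgpos : ∀ m, 1 ≤ m → ∀ ω, 0 < estimate lam (g m) (fun i => p m i ω))
    (hFDR : 0 < liminf (fun m => fdr (P m) (p m) α lam (g m) (I₀ m)) atTop)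
    (hA4 : ∃ C : ℝ, 1 < C ∧ Tendsto (fun m => P m {ω |
      C * α / lam * max (countLE (fun i => p m i ω) lam) 1 ≤
        estimate lam (g m) (fun i => p m i ω)}) atTop (𝓝 1)) :
    (Consistent P p α lam g I₀ → Tendsto (fun m => (I₀ m)ᶜ.card) atTop atTop) ∧
    (∀ κ₀ : ℝ, 0 < κ₀ → κ₀ ≤ 1 →
      Tendsto (fun m => ((I₀ m).card : ℝ) / (m : ℝ)) atTop (𝓝 κ₀) →
      (∀ m, 1 ≤ m → iIndepFun (fun (i : {i // i ∈ (I₀ m)ᶜ}) => p m i) (P m)) →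
      (∀ m, 1 ≤ m → ∀ i ∈ (I₀ m)ᶜ,
        pdf.IsUniform (p m i) (Set.Icc 0 lam) (P m) volume) →
      ¬ Consistent P p α lam g I₀) := by
  obtain ⟨C, hC, hA4⟩ := hA4
  have hlam0 : 0 < lam := hα₀.trans_le hαlam
  have hC0 : 0 < C := by linarith
  have hρ1 : 1 / C < 1 := (div_lt_one hC0).2 hC
  have hbound : ∀ q : ℝ, q < 1 → ∀ᶠ m in atTop, q < (P m).real {ω |
      C * α / lam * max (countLE (fun i => p m i ω) lam) 1 ≤
        estimate lam (g m) (fun i => p m i ω)} := fun q hq => by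
    have := (ENNReal.tendsto_toReal ENNReal.one_ne_top).comp hA4
    rw [ENNReal.toReal_one] at this
    exact this.eventually_const_lt hq
  refine ⟨fun hcons => ?_, fun κ₀ _ _ _ hind hunif hcons => ?_⟩
  · by_contra hnot
    obtain ⟨k, hk⟩ : ∃ k : ℕ, ∃ᶠ m in atTop, (I₀ m)ᶜ.card ≤ k := by
      simp only [tendsto_atTop, not_forall] at hnot
      obtain ⟨k, hk⟩ := hnot
      exact ⟨k, (not_eventually.1 hk).mono fun m hm => (not_le.1 hm).le⟩
    set θ : ℝ := (1 - lam) / (1 - 3 * lam / 4) with hθ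
    have hθ1 : 0 < 1 - θ := by
      rw [hθ, sub_pos, div_lt_one (by linarith)]
      linarith
    -- `q` bounds from below the probability that no true null is under `a` while many are under
    -- `lam`. Half of it absorbs the failure of the estimator bound.
    set q : ℝ := (1 - θ) * (Real.exp (-(2 * (k : ℝ))) / 2) with hq
    have hq0 : 0 < q := by positivity
    set ρ : ℝ := (1 + 1 / C) / 2 with hρ
    have hρ0 : 0 ≤ ρ := by positivity
    have hρ2 : ρ < 1 := by linarith
    obtain ⟨N, hN⟩ := eventually_atTop.1 (eventually_shift_bounds (k := k) hlam0 hlam hC)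
    have hsmall := hcons.eventually_measureReal_numFalseRej_eq_zero_lt hFDR
      (ε := (1 - ρ) * (q / 2)) (mul_pos (by linarith) (by linarith))
    -- With at most `k` false nulls, `m ≥ N + k + 1` ensures `m₀ ≥ N`.
    obtain ⟨m, hmk, hm1, hm2, hm3⟩ := (hk.and_eventually
      (hsmall.and ((hbound (1 - q / 2) (by linarith)).and (eventually_ge_atTop (N + k + 1))))).exists
    have hm : 1 ≤ m := by omega
    have hcard : N ≤ (I₀ m).card := by
      have := Finset.card_add_card_compl (I₀ m)
      rw [Fintype.card_fin] at this
      omega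
    obtain ⟨b1, b2, b3, b4⟩ := hN _ hcard
    have hlow := (hBI m hm).le_measureReal_numFalseRej_eq_zero hm (hm₀ m hm) hα₀ hlam0 hlam
      (hg m hm) (hgpos m hm) hC hmk hρ0 hρ2.le b1 b2 b3
    refine absurd (hlow.trans_lt hm1) (not_lt.2 (mul_le_mul_of_nonneg_left ?_ (by linarith)))
    have := mul_le_mul_of_nonneg_left b4 hθ1.le
    linarith
  · have hsmall := hcons.eventually_measureReal_numFalseRej_eq_zero_lt hFDR
      (ε := (1 - 1 / C) * (1 / 2)) (mul_pos (by linarith) (by norm_num))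
    obtain ⟨m, hm1, hm2, hm⟩ := (hsmall.and
      ((hbound (1 / 2) (by norm_num)).and (eventually_ge_atTop 1))).exists
    have hlow := (hBI m hm).le_measureReal_numFalseRej_eq_zero_of_uniform hm hα₀ hlam0 hlam
      (hg m hm) (hgpos m hm) hC (hind m hm) (hunif m hm)
    have := mul_le_mul_of_nonneg_left hm2.le (sub_nonneg.2 hρ1.le)
    linarith
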